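/- **Setting.** Transfer functions are matrices of rational functions of $z$ with real coefficients. Such a matrix is *causal* if it has no pole at $z=\infty$, *strictly causal* if it is $z^{-1}$ times a causal one, and *stable* (and causal) if it is analytic in $\{|z|\ge 1\}$, including $z=\infty$. A transfer matrix is *minimum phase* if it is stable and has full column rank at every point of $\{|z|\ge 1\}$, including $z=\infty$. Let $y=(y_1,y_2)$ be a zero-mean process with finite second moments, with $y_1(t)\in\mathbb R^m$, $y_2(t)\in\mathbb R^p$, and with an innovation representation $$y_1(t)=W_1(z)e(t),\qquad y_2(t)=W_2(z)e(t),$$ where $W_1$ ($m\times m$) and $W_2$ ($p\times m$) are stable, $\det W_1\not\equiv 0$, and $e$ is the $m$-dimensional normalized innovation of $y$: a white noise with covariance $I_m$ such that the one-step prediction error of $y(t)$ from its own strict past is $D\,e(t)$ for a constant matrix $D$ of full column rank. Assume that the feedback channel $H:=W_2W_1^{-1}$ is causal. Let $\mathbf H_{t-1}^-(y_2)$ be the closed linear span of the components of $y_2(s)$, $s\le t-1$, and let $\mathbb E\{\cdot\mid \mathbf H_{t-1}^-(y_2)\}$ be the (componentwise) orthogonal projection onto it. A *feedback representation* is a triple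 $(F,H',K)$ with $$y_1=F(z)y_2+v,\qquad v=K(z)e,\qquad y_2=H'(z)y_1,$$ where $F$ ($m\times p$) and $H'$ ($p\times m$) are causal, possibly unstable, at least one of them is strictly causal, $K$ ($m\times m$) is stable and causal, $v$ is zero-mean and wide-sense stationary, and the loop is well-posed and internally stable, i.e. $(I-FH')^{-1}$, $(I-FH')^{-1}F$, $(I-H'F)^{-1}H'$ and $(I-H'F)^{-1}$ exist and are stable. For unstable $G=N/d$, with $N,d$ polynomial in $z^{-1}$, the relation $x=G(z)u$ means $d(z^{-1})x=N(z^{-1})u$, for every such fraction. **Theorem.** Assume that $W_2$ is minimum phase. Then there are a stable causal $F_+(z)$ and a constant $m\times m$ matrix $K_+$, nonsingular (so minimum phase), such that: 1. $(z^{-1}F_+,\,W_2W_1^{-1},\,K_+)$ is a feedback representation, so that $y_1(t)=F_+(z)y_2(t-1)+K_+e(t)$. 2. $F_+$ is the transfer function of the one-step Wiener predictor of $y_1(t)$ from the strict past of $y_2$: $F_+(z)y_2(t-1)=\mathbb E\{y_1(t)\mid \mathbf H_{t-1}^-(y_2)\}$. The prediction error is $y_1(t)-F_+(z)y_2(t-1)=K_+e(t)$,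 and it is uncorrelated with $y_2(s)$ for all $s<t$. 3. For every feedback representation $(z^{-1}\bar F,H',K)$ with $\bar F$ stable and causal and $K$ a constant matrix, $K=K_+$ and $\bar F(z)y_2(t-1)=\mathbb E\{y_1(t)\mid \mathbf H_{t-1}^-(y_2)\}$. 4. The representation is the unique feedback representation whose noise $v(t)$ is uncorrelated with the strict past of $y_2$: for every feedback representation $(F,H',K)$ with that property, $v(t)=K_+e(t)$, $K=K_+$, $H'=W_2W_1^{-1}$ and $FW_2=z^{-1}F_+W_2$; moreover $F=z^{-1}F_+$ if $p=m$. -/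

import Mathlib

open MeasureTheory
open scoped ENNReal

/-!
Transfer functions are rational functions with real coefficients.  They are written as elements of
`RatFunc ℝ` in the delay variable `ζ = z⁻¹` (so `RatFunc.X` is the one step delay `z⁻¹`, the region
`|z| ≥ 1`, including `z = ∞`, is the closed unit disc `‖ζ‖ ≤ 1`, and `z = ∞` is `ζ = 0`).
-/

section TransferFunctions

variable {ι κ : Type*}

/-- All the poles of the entries lie in `|z| < 1`, and there is no pole at `z = ∞`:
the matrix is analytic in `|z| ≥ 1` (stable and causal). -/
def IsStableTF (G : Matrix ι κ (RatFunc ℝ)) : Prop :=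
  ∀ i j, ∀ ζ : ℂ, ‖ζ‖ ≤ 1 → Polynomial.aeval ζ (G i j).denom ≠ 0

/-- No pole at `z = ∞` (a proper, possibly unstable, transfer matrix). -/
def IsCausalTF (G : Matrix ι κ (RatFunc ℝ)) : Prop :=
  ∀ i j, (G i j).denom.eval 0 ≠ 0

/-- Causal, with at least one delay. -/
def IsStrictlyCausalTF (G : Matrix ι κ (RatFunc ℝ)) : Prop :=
  ∃ G' : Matrix ι κ (RatFunc ℝ), IsCausalTF G' ∧ G = (RatFunc.X : RatFunc ℝ) • G'

/-- The value of a transfer matrix at a complex value `ζ` of `z⁻¹`. -/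
noncomputable def evalTF (G : Matrix ι κ (RatFunc ℝ)) (ζ : ℂ) : Matrix ι κ ℂ :=
  G.map fun g => RatFunc.eval (algebraMap ℝ ℂ) ζ g

/-- Minimum phase: stable, and of full column rank at every point of `|z| ≥ 1`,
including `z = ∞`. -/
def IsMinimumPhase [Fintype κ] (G : Matrix ι κ (RatFunc ℝ)) : Prop :=
  IsStableTF G ∧ ∀ ζ : ℂ, ‖ζ‖ ≤ 1 → Function.Injective (evalTF G ζ).mulVec

/-- A constant matrix, seen as a transfer matrix. -/
noncomputable def constTF (K : Matrix ι κ ℝ) : Matrix ι κ (RatFunc ℝ) :=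
  K.map RatFunc.C

/-- The coefficient of `z⁻ᵏ` in the expansion of `g` at `z = ∞`. -/
noncomputable def impulseCoeff (g : RatFunc ℝ) (k : ℕ) : ℝ :=
  ((g : LaurentSeries ℝ)).coeff (k : ℤ)

/-- Well-posedness and internal stability of the loop `y₁ = F y₂ + v`, `y₂ = H y₁ + r`:
the four blocks of the transfer matrix from `(v, r)` to `(y₁, y₂)` exist and are stable. -/
def IsInternallyStable [Fintype ι] [Fintype κ] [DecidableEq ι] [DecidableEq κ]
    (F : Matrix ι κ (RatFunc ℝ)) (H : Matrix κ ι (RatFunc ℝ)) : Prop :=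
  IsUnit (1 - F * H) ∧ IsUnit (1 - H * F) ∧
  IsStableTF (1 - F * H)⁻¹ ∧ IsStableTF ((1 - F * H)⁻¹ * F) ∧
  IsStableTF ((1 - H * F)⁻¹ * H) ∧ IsStableTF (1 - H * F)⁻¹

end TransferFunctions

section Processes

variable {Ω : Type*} [MeasurableSpace Ω] {μ : Measure Ω} {ι κ : Type*}

/-- A discrete-time process with components indexed by `ι` and finite second moments.
The inner product of `Lp ℝ 2 μ` is `⟪x, y⟫ = E[x y]`. -/
abbrev RandProc (ι : Type*) {Ω : Type*} [MeasurableSpace Ω] (μ : Measure Ω) : Type _ :=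
  ℤ → ι → Lp ℝ 2 μ

/-- Zero mean and wide sense stationary. -/
def IsWideSenseStationary (x : RandProc ι μ) : Prop :=
  (∀ t i, ∫ ω, (x t i : Ω → ℝ) ω ∂μ = 0) ∧
  ∀ (h t s : ℤ) (i j : ι), inner ℝ (x (t + h) i) (x (s + h) j) = inner ℝ (x t i) (x s j)

/-- The joint process `(x, y)`. -/
def jointProcess (x : RandProc ι μ) (y : RandProc κ μ) : RandProc (ι ⊕ κ) μ :=
  fun t => Sum.elim (x t) (y t)

/-- All the values of `x` are uncorrelated with all the values of `y` (zero mean processes). -/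
def IsUncorrelated (x : RandProc ι μ) (y : RandProc κ μ) : Prop :=
  ∀ t s i j, inner ℝ (x t i) (y s j) = 0

/-- `x t` is uncorrelated with `y s` whenever `s < t` (zero mean processes). -/
def IsUncorrelatedWithStrictPast (x : RandProc ι μ) (y : RandProc κ μ) : Prop :=
  ∀ t s, s < t → ∀ i j, inner ℝ (x t i) (y s j) = 0

/-- White noise: zero mean, with `E[e(t) e(s)ᵀ] = I` if `t = s` and `0` otherwise. -/
def IsNormalizedWhiteNoise [DecidableEq ι] (e : RandProc ι μ) : Prop :=
  (∀ t i, ∫ ω, (e t i : Ω → ℝ) ω ∂μ = 0) ∧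
  ∀ t s i j, inner ℝ (e t i) (e s j) = if t = s ∧ i = j then (1 : ℝ) else 0

/-- The past space at time `t`: the closed linear span of the components of `y s`, `s ≤ t`. -/
noncomputable def pastSpace (y : RandProc ι μ) (t : ℤ) : Submodule ℝ (Lp ℝ 2 μ) :=
  (Submodule.span ℝ {x | ∃ s ≤ t, ∃ i, x = y s i}).topologicalClosure

noncomputable instance instHasOrthogonalProjectionPastSpace (y : RandProc ι μ) (t : ℤ) :
    (pastSpace y t).HasOrthogonalProjection := by
  unfold pastSpace
  infer_instance

/-- The one step ahead Wiener predictor of `x t` from the strict past of `y`: the componentwise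
orthogonal projection onto the past space of `y` at time `t - 1`. -/
noncomputable def wienerPredictor (x : RandProc κ μ) (y : RandProc ι μ) : RandProc κ μ :=
  fun t i => (pastSpace y (t - 1)).starProjection (x t i)

/-- `e` is a normalized innovation of `y`: a normalized white noise such that the one step
prediction error of `y` from its own strict past is `D e(t)`, with `D` a constant matrix of full
column rank. -/
def IsNormalizedInnovation [Fintype κ] [DecidableEq κ] (e : RandProc κ μ) (y : RandProc ι μ) :
    Prop :=
  IsNormalizedWhiteNoise e ∧
  ∃ D : Matrix ι κ ℝ, Function.Injective D.mulVec ∧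
    ∀ t i, y t i - wienerPredictor y y t i = ∑ j, D i j • e t j

/-- `y(t) = G(z) u(t)` for a stable causal `G = ∑ Gₖ z⁻ᵏ`: `y(t) = ∑ₖ Gₖ u(t - k)`,
with mean square convergence. -/
def IsFilterResponse [Fintype κ] (G : Matrix ι κ (RatFunc ℝ)) (u : RandProc κ μ)
    (y : RandProc ι μ) : Prop :=
  ∀ t i, HasSum (fun k : ℕ => ∑ j, impulseCoeff (G i j) k • u (t - k) j) (y t i)

/-- The polynomial `q` in the delay operator `z⁻¹`, applied to `x` at time `t`. -/
noncomputable def applyDelay (q : Polynomial ℝ) (x : ℤ → Lp ℝ 2 μ) (t : ℤ) : Lp ℝ 2 μ :=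
  q.sum fun k a => a • x (t - k)

/-- `y(t) = G(z) u(t)` for a rational `G` that need not be stable: the processes satisfy the
difference equations `d(z⁻¹) y(t) = N(z⁻¹) u(t)` given by the polynomial fractions `G = N / d`. -/
def IsTransferRelation [Fintype κ] (G : Matrix ι κ (RatFunc ℝ)) (u : RandProc κ μ)
    (y : RandProc ι μ) : Prop :=
  ∀ (d : Polynomial ℝ) (N : Matrix ι κ (Polynomial ℝ)), d ≠ 0 →
    (∀ i j, algebraMap (Polynomial ℝ) (RatFunc ℝ) d * G i j
      = algebraMap (Polynomial ℝ) (RatFunc ℝ) (N i j)) →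
    ∀ t i, applyDelay d (fun s => y s i) t = ∑ j, applyDelay (N i j) (fun s => u s j) t

/-- `y(t) = W(z) e(t)` is an innovation representation. -/
structure IsInnovationRepresentation [Fintype κ] [DecidableEq κ] (W : Matrix ι κ (RatFunc ℝ))
    (e : RandProc κ μ) (y : RandProc ι μ) : Prop where
  stable : IsStableTF W
  innovation : IsNormalizedInnovation e y
  response : IsFilterResponse W e y

/-- Feedback model `y₁ = F(z) y₂ + v`, `y₂ = H(z) y₁ + r`. -/
structure IsFeedbackModel [Fintype ι] [Fintype κ] [DecidableEq ι] [DecidableEq κ]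
    (F : Matrix ι κ (RatFunc ℝ)) (H : Matrix κ ι (RatFunc ℝ))
    (y₁ : RandProc ι μ) (y₂ : RandProc κ μ) (v : RandProc ι μ) (r : RandProc κ μ) : Prop where
  stationary : IsWideSenseStationary (jointProcess v r)
  uncorrelated : IsUncorrelated v r
  causal_F : IsCausalTF F
  causal_H : IsCausalTF H
  delay : IsStrictlyCausalTF F ∨ IsStrictlyCausalTF H
  internally_stable : IsInternallyStable F H
  forward : IsTransferRelation F y₂ (fun t i => y₁ t i - v t i)
  feedback : IsTransferRelation H y₁ (fun t i => y₂ t i - r t i)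

/-- Feedback representation `y₁ = F(z) y₂ + K(z) e`, `y₂ = H(z) y₁`, with noise `v = K(z) e`,
`K` stable and causal, and no modeling error. -/
structure IsFeedbackRepresentation [Fintype ι] [Fintype κ] [DecidableEq ι] [DecidableEq κ]
    (F : Matrix ι κ (RatFunc ℝ)) (H : Matrix κ ι (RatFunc ℝ)) (K : Matrix ι ι (RatFunc ℝ))
    (e : RandProc ι μ) (y₁ : RandProc ι μ) (y₂ : RandProc κ μ) (v : RandProc ι μ) : Prop where
  stable_K : IsStableTF K
  noise : IsFilterResponse K e v
  model : IsFeedbackModel F H y₁ y₂ v 0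

end Processes

/-!
Let `y₁ = W₁ e` and `y₂ = W₂ e`, with `e` a normalized white noise and `W₂` minimum phase.

Two facts carry the theorem.  First, `W₂` has a stable left inverse `L`
(`IsMinimumPhase.exists_left_inverse`).  Hence `e = L y₂`, and the past spaces of `y₂` and of `e`
are the same: predicting from the strict past of `y₂` amounts to dropping the term `W₁(∞) e(t)` of
`y₁(t)` (`sub_wienerPredictor_eq`).  So `K₊ = W₁(∞)` is the only possible constant, and
`F₊ = z (W₁ - W₁(∞)) L` is stable, causal, and satisfies `z⁻¹ F₊ W₂ = W₁ - K₊`.  The matrix `K₊` is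
invertible because `L(∞) H(∞)` is a left inverse of it, where `H = W₂ W₁⁻¹` is causal; and
`1 - z⁻¹ F₊ H = K₊ W₁⁻¹`, from which internal stability follows (`isInternallyStable_of_eq`).

Second, a relation `y = G u` between responses `u = B e`, `y = A e` to the white noise, even for an
unstable `G`, is the same as the identity `A = G B` of rational matrices (`isTransferRelation_iff`),
since the impulse response is the covariance with the past of `e`.  A feedback representation
`(F, H', K)` therefore amounts to `W₁ - K = F W₂` and `W₂ = H' W₁`, together with its stability
conditions (`IsFeedbackRepresentation.transfer_eq`).  If its noise `K e` is uncorrelated with the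
strict past of `y₂`, that is of `e`, then `K` is constant; evaluation at `z = ∞`, where `F` or `H'`
vanishes, gives `K = K₊`, and the uniqueness claims are then algebra.

The analytic input is that a stable rational function has an absolutely summable impulse response
(`summable_norm_impulseCoeff`), so that stable filters act on bounded processes and compose as
their transfer matrices multiply (`IsFilterResponse.comp_iff`).
-/

/-! ### Rational functions without poles in a given set -/

/-- The subring of the real rational functions that have no pole in the set `S` of complex
numbers. -/
noncomputable def regularOn (S : Set ℂ) : Subring (RatFunc ℝ) where
  carrier := {g | ∀ ζ ∈ S, Polynomial.aeval ζ g.denom ≠ 0}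
  zero_mem' := by simp
  one_mem' := by simp
  add_mem' := by
    intro a b ha hb ζ hζ h
    have := Polynomial.aeval_eq_zero_of_dvd_aeval_eq_zero (RatFunc.denom_add_dvd a b) h
    rw [map_mul] at this
    exact (mul_ne_zero (ha ζ hζ) (hb ζ hζ)) this
  mul_mem' := by
    intro a b ha hb ζ hζ h
    have := Polynomial.aeval_eq_zero_of_dvd_aeval_eq_zero (RatFunc.denom_mul_dvd a b) h
    rw [map_mul] at this
    exact (mul_ne_zero (ha ζ hζ) (hb ζ hζ)) this
  neg_mem' := by
    intro a ha ζ hζ h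
    have hd : (-a).denom ∣ a.denom := by
      rw [RatFunc.denom_dvd a.denom_ne_zero]
      exact ⟨-a.num, by rw [map_neg, neg_div, RatFunc.num_div_denom]⟩
    exact ha ζ hζ (Polynomial.aeval_eq_zero_of_dvd_aeval_eq_zero hd h)

theorem mem_regularOn {S : Set ℂ} {g : RatFunc ℝ} :
    g ∈ regularOn S ↔ ∀ ζ ∈ S, Polynomial.aeval ζ g.denom ≠ 0 := Iff.rfl

theorem regularOn_anti {S T : Set ℂ} (h : S ⊆ T) : regularOn T ≤ regularOn S :=
  fun _ hg ζ hζ => hg ζ (h hζ)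

theorem algebraMap_mem_regularOn (S : Set ℂ) (q : Polynomial ℝ) :
    algebraMap (Polynomial ℝ) (RatFunc ℝ) q ∈ regularOn S := by
  intro ζ _
  simp

theorem C_mem_regularOn (S : Set ℂ) (a : ℝ) : RatFunc.C a ∈ regularOn S := by
  intro ζ _
  simp

theorem X_mem_regularOn (S : Set ℂ) : (RatFunc.X : RatFunc ℝ) ∈ regularOn S := by
  intro ζ _
  simp

theorem div_mem_regularOn {S : Set ℂ} (n : Polynomial ℝ) {d : Polynomial ℝ}
    (hd0 : d ≠ 0) (hd : ∀ ζ ∈ S, Polynomial.aeval ζ d ≠ 0) :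
    algebraMap (Polynomial ℝ) (RatFunc ℝ) n / algebraMap _ _ d ∈ regularOn S := by
  intro ζ hζ h
  exact hd ζ hζ (Polynomial.aeval_eq_zero_of_dvd_aeval_eq_zero
    ((RatFunc.denom_dvd hd0).2 ⟨n, rfl⟩) h)

/-- Evaluation at a point of `S`, on the rational functions without poles in `S`. -/
noncomputable def evalOn {S : Set ℂ} {ζ : ℂ} (hζ : ζ ∈ S) : regularOn S →+* ℂ where
  toFun g := RatFunc.eval (algebraMap ℝ ℂ) ζ g
  map_zero' := RatFunc.eval_zero _ _
  map_one' := RatFunc.eval_one _ _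
  map_add' g h := RatFunc.eval_add _ _ (g.2 ζ hζ) (h.2 ζ hζ)
  map_mul' g h := RatFunc.eval_mul _ _ (g.2 ζ hζ) (h.2 ζ hζ)

theorem aeval_zero_eq (q : Polynomial ℝ) : Polynomial.aeval (0 : ℂ) q = (q.coeff 0 : ℂ) := by
  simp [Polynomial.aeval_def, Polynomial.eval₂_at_zero]

/-- The closed unit disc, which is the region `|z| ≥ 1` in the variable `ζ = z⁻¹`. -/
abbrev unitDisc : Set ℂ := {ζ | ‖ζ‖ ≤ 1}

theorem unitDisc_regular_le : regularOn unitDisc ≤ regularOn {0} :=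
  regularOn_anti (by simp)

section

variable {ι κ l : Type*}

theorem isCausalTF_iff {G : Matrix ι κ (RatFunc ℝ)} :
    IsCausalTF G ↔ ∀ i j, G i j ∈ regularOn {0} := by
  simp [IsCausalTF, mem_regularOn, aeval_zero_eq, Polynomial.coeff_zero_eq_eval_zero]

theorem IsStableTF.isCausalTF {G : Matrix ι κ (RatFunc ℝ)} (h : IsStableTF G) : IsCausalTF G :=
  isCausalTF_iff.2 fun i j => unitDisc_regular_le (h i j)

theorem IsStableTF.mul [Fintype κ] {G : Matrix ι κ (RatFunc ℝ)} {H : Matrix κ l (RatFunc ℝ)}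
    (hG : IsStableTF G) (hH : IsStableTF H) : IsStableTF (G * H) := fun i j =>
  Subring.sum_mem (regularOn unitDisc) fun k _ => Subring.mul_mem _ (hG i k) (hH k j)

theorem IsStableTF.add {G H : Matrix ι κ (RatFunc ℝ)}
    (hG : IsStableTF G) (hH : IsStableTF H) : IsStableTF (G + H) := fun i j =>
  Subring.add_mem (regularOn unitDisc) (hG i j) (hH i j)

theorem IsStableTF.sub {G H : Matrix ι κ (RatFunc ℝ)}
    (hG : IsStableTF G) (hH : IsStableTF H) : IsStableTF (G - H) := fun i j =>
  Subring.sub_mem (regularOn unitDisc) (hG i j) (hH i j)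

theorem IsStableTF.smul {G : Matrix ι κ (RatFunc ℝ)} {g : RatFunc ℝ}
    (hg : g ∈ regularOn unitDisc) (hG : IsStableTF G) : IsStableTF (g • G) := fun i j =>
  Subring.mul_mem (regularOn unitDisc) hg (hG i j)

theorem isStableTF_constTF (K : Matrix ι κ ℝ) : IsStableTF (constTF K) := fun i j =>
  C_mem_regularOn unitDisc (K i j)

theorem isStableTF_one [DecidableEq ι] : IsStableTF (1 : Matrix ι ι (RatFunc ℝ)) := fun i j => by
  rw [Matrix.one_apply]
  split_ifs
  · exact Subring.one_mem (regularOn unitDisc)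
  · exact Subring.zero_mem (regularOn unitDisc)

theorem isStableTF_map_algebraMap (N : Matrix ι κ (Polynomial ℝ)) :
    IsStableTF (N.map (algebraMap (Polynomial ℝ) (RatFunc ℝ))) := fun i j =>
  algebraMap_mem_regularOn unitDisc (N i j)

/-! ### Stable left inverses of minimum phase matrices -/

/-- A matrix of full column rank over a field has a maximal nonzero minor. -/
theorem exists_submatrix_det_ne_zero {k : Type*} [Field k] [Fintype ι] [Fintype κ]
    [DecidableEq κ] (A : Matrix ι κ k) (hA : Function.Injective A.mulVec) :
    ∃ f : κ → ι, (A.submatrix f id).det ≠ 0 := by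
  classical
  obtain ⟨b, hb⟩ := A.mulVecLin.exists_leftInverse_of_injective (LinearMap.ker_eq_bot.2 hA)
  have hB : LinearMap.toMatrix' b * A = 1 := by
    rw [← LinearMap.toMatrix'_id, ← hb, LinearMap.toMatrix'_comp, ← Matrix.toLin'_apply',
      LinearMap.toMatrix'_toLin']
  have hspan : Submodule.span k (Set.range A.row) = ⊤ := by
    rw [← range_vecMulLinear, LinearMap.range_eq_top]
    intro x
    exact ⟨Matrix.vecMul x (LinearMap.toMatrix' b), by simp [Matrix.vecMul_vecMul, hB]⟩
  obtain ⟨σ, a, -, hsp, hli⟩ := exists_linearIndependent' k A.row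
  let b := Module.Basis.mk hli (by rw [hsp, hspan])
  let φ : κ ≃ σ := (Pi.basisFun k κ).indexEquiv b
  refine ⟨a ∘ φ, ?_⟩
  have hu : IsUnit (A.submatrix (a ∘ φ) id) := by
    rw [← Matrix.linearIndependent_rows_iff_isUnit]
    exact hli.comp φ φ.injective
  exact ((Matrix.isUnit_iff_isUnit_det _).1 hu).ne_zero

/-- A minimum phase matrix `W` has a stable left inverse.  The polynomials `a` such that `a • 1`
is a stable multiple of `W` form an ideal; its generator has no zero in the disc, because at each
point some maximal minor of `W` does not vanish. -/
theorem IsMinimumPhase.exists_left_inverse [Fintype ι] [Fintype κ] [DecidableEq κ]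
    {W : Matrix ι κ (RatFunc ℝ)} (hW : IsMinimumPhase W) :
    ∃ L : Matrix κ ι (RatFunc ℝ), IsStableTF L ∧ L * W = 1 := by
  classical
  obtain ⟨hst, hinj⟩ := hW
  let I : Ideal (Polynomial ℝ) :=
    { carrier := {a | ∃ L : Matrix κ ι (RatFunc ℝ), IsStableTF L ∧
        L * W = algebraMap (Polynomial ℝ) (RatFunc ℝ) a • 1}
      zero_mem' := ⟨0, fun i j => Subring.zero_mem (regularOn unitDisc), by simp⟩
      add_mem' := by
        rintro a b ⟨L, hL, h⟩ ⟨L', hL', h'⟩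
        exact ⟨L + L', hL.add hL', by rw [Matrix.add_mul, h, h', map_add, add_smul]⟩
      smul_mem' := by
        rintro c a ⟨L, hL, h⟩
        exact ⟨algebraMap _ _ c • L, .smul (algebraMap_mem_regularOn _ c) hL, by
          rw [Matrix.smul_mul, h, smul_smul, smul_eq_mul, map_mul]⟩ }
  obtain ⟨g, hg⟩ := (IsPrincipalIdealRing.principal I).principal
  have hgI : g ∈ I := hg ▸ Submodule.mem_span_singleton_self g
  have hne (ζ : ℂ) (hζ : ζ ∈ unitDisc) : Polynomial.aeval ζ g ≠ 0 := by
    obtain ⟨f, hf⟩ := exists_submatrix_det_ne_zero _ (hinj ζ hζ)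
    let M : Matrix κ κ (regularOn unitDisc) := fun i j => ⟨W (f i) j, hst (f i) j⟩
    have hM : M.map (Subring.subtype _) = W.submatrix f id := rfl
    have hM' : M.map (evalOn hζ) = (evalTF W ζ).submatrix f id := rfl
    let δ : RatFunc ℝ := Subring.subtype _ M.det
    have hδW : δ = (W.submatrix f id).det := by
      rw [← hM]
      exact RingHom.map_det (Subring.subtype _) M
    have hnum : Polynomial.aeval ζ δ.num ≠ 0 := by
      intro h0
      apply hf
      rw [← hM']
      have := RingHom.map_det (evalOn hζ) M
      change _ = (M.map (evalOn hζ)).det at this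
      rw [← this]
      change RatFunc.eval (algebraMap ℝ ℂ) ζ δ = 0
      rw [RatFunc.eval, ← Polynomial.aeval_def, h0, zero_div]
    have hmem : δ.num ∈ I := by
      let P : Matrix κ ι (RatFunc ℝ) := (1 : Matrix ι ι (RatFunc ℝ)).submatrix f id
      have hP : P * W = W.submatrix f id := by
        ext i j
        simp [P, Matrix.mul_apply, Matrix.one_apply]
      refine ⟨algebraMap _ _ δ.denom • ((M.adjugate.map (Subring.subtype _)) * P),
        .smul (algebraMap_mem_regularOn _ _) (.mul (fun i j => (M.adjugate i j).2)
          fun i j => isStableTF_one (f i) j), ?_⟩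
      have hadj : M.adjugate.map (Subring.subtype _) = (W.submatrix f id).adjugate := by
        rw [← hM]
        exact RingHom.map_adjugate (Subring.subtype _) M
      rw [Matrix.smul_mul, Matrix.mul_assoc, hP, hadj, Matrix.adjugate_mul, ← hδW, smul_smul]
      congr 1
      rw [mul_comm]
      nth_rewrite 1 [← RatFunc.num_div_denom δ]
      exact div_mul_cancel₀ _ (RatFunc.algebraMap_ne_zero δ.denom_ne_zero)
    rw [hg] at hmem
    obtain ⟨c, hc⟩ := Submodule.mem_span_singleton.1 hmem
    intro h0
    rw [← hc, smul_eq_mul, map_mul, h0, mul_zero] at hnum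
    exact hnum rfl
  have hg0 : g ≠ 0 := by
    rintro rfl
    exact hne 0 (by simp) (by simp)
  obtain ⟨L, hL, h⟩ := hgI
  refine ⟨(algebraMap _ (RatFunc ℝ) 1 / algebraMap (Polynomial ℝ) (RatFunc ℝ) g) • L,
    .smul (div_mem_regularOn 1 hg0 hne) hL, ?_⟩
  rw [Matrix.smul_mul, h, smul_smul, map_one,
    one_div_mul_cancel (RatFunc.algebraMap_ne_zero hg0), one_smul]

end

/-! ### Impulse responses -/

/-- The expansion of a rational function at `z = ∞`, as a power series in `z⁻¹`; meaningful if
there is no pole at `z = ∞`. -/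
noncomputable def impulseSeries (g : RatFunc ℝ) : PowerSeries ℝ := PowerSeries.mk (impulseCoeff g)

theorem coeff_impulseSeries (g : RatFunc ℝ) (k : ℕ) :
    PowerSeries.coeff k (impulseSeries g) = impulseCoeff g k :=
  PowerSeries.coeff_mk _ _

theorem impulseSeries_eq {g : RatFunc ℝ} {φ : PowerSeries ℝ}
    (h : (φ : LaurentSeries ℝ) = (g : LaurentSeries ℝ)) : impulseSeries g = φ := by
  ext k
  rw [coeff_impulseSeries, impulseCoeff, ← h, LaurentSeries.coeff_coe_powerSeries]

theorem mul_denom (g : RatFunc ℝ) :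
    g * algebraMap (Polynomial ℝ) (RatFunc ℝ) g.denom = algebraMap _ _ g.num := by
  nth_rewrite 1 [← RatFunc.num_div_denom g]
  exact div_mul_cancel₀ _ (RatFunc.algebraMap_ne_zero g.denom_ne_zero)

theorem coe_impulseSeries {g : RatFunc ℝ} (hg : g ∈ regularOn {0}) :
    ((impulseSeries g : PowerSeries ℝ) : LaurentSeries ℝ) = (g : LaurentSeries ℝ) := by
  have h0 : PowerSeries.constantCoeff (g.denom : PowerSeries ℝ) ≠ 0 := by
    have := hg 0 rfl
    rw [aeval_zero_eq] at this
    rw [← PowerSeries.coeff_zero_eq_constantCoeff_apply, Polynomial.coeff_coe]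
    exact_mod_cast this
  have key : (((g.num : PowerSeries ℝ) * (g.denom : PowerSeries ℝ)⁻¹ : PowerSeries ℝ) :
      LaurentSeries ℝ) = (g : LaurentSeries ℝ) := by
    have hd : ((g.denom : RatFunc ℝ) : LaurentSeries ℝ) ≠ 0 := by
      rw [Ne, map_eq_zero]
      exact RatFunc.algebraMap_ne_zero g.denom_ne_zero
    apply mul_right_cancel₀ hd
    rw [← map_mul]
    have hnum : g * (g.denom : RatFunc ℝ) = (g.num : RatFunc ℝ) := mul_denom g
    rw [hnum, ← RatFunc.coe_coe,
      ← RatFunc.coe_coe, ← PowerSeries.coe_mul, mul_assoc, PowerSeries.inv_mul_cancel _ h0, mul_one]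
  rw [impulseSeries_eq key, key]

theorem impulseSeries_mul {g h : RatFunc ℝ} (hg : g ∈ regularOn {0}) (hh : h ∈ regularOn {0}) :
    impulseSeries (g * h) = impulseSeries g * impulseSeries h := by
  apply impulseSeries_eq
  rw [PowerSeries.coe_mul, coe_impulseSeries hg, coe_impulseSeries hh, map_mul]

theorem impulseSeries_algebraMap (q : Polynomial ℝ) :
    impulseSeries (algebraMap (Polynomial ℝ) (RatFunc ℝ) q) = q :=
  impulseSeries_eq (RatFunc.coe_coe q)

theorem impulseCoeff_mul {g h : RatFunc ℝ} (hg : g ∈ regularOn {0}) (hh : h ∈ regularOn {0})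
    (k : ℕ) : impulseCoeff (g * h) k =
      ∑ x ∈ Finset.HasAntidiagonal.antidiagonal k, impulseCoeff g x.1 * impulseCoeff h x.2 := by
  rw [← coeff_impulseSeries, impulseSeries_mul hg hh, PowerSeries.coeff_mul]
  simp only [coeff_impulseSeries]

theorem impulseCoeff_mul_zero {g h : RatFunc ℝ} (hg : g ∈ regularOn {0})
    (hh : h ∈ regularOn {0}) : impulseCoeff (g * h) 0 = impulseCoeff g 0 * impulseCoeff h 0 := by
  simp [impulseCoeff_mul hg hh]

theorem impulseCoeff_sub (g h : RatFunc ℝ) (k : ℕ) :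
    impulseCoeff (g - h) k = impulseCoeff g k - impulseCoeff h k := by
  simp [impulseCoeff]

theorem impulseCoeff_sum {κ : Type*} (s : Finset κ) (g : κ → RatFunc ℝ) (k : ℕ) :
    impulseCoeff (∑ j ∈ s, g j) k = ∑ j ∈ s, impulseCoeff (g j) k := by
  simp [impulseCoeff, HahnSeries.coeff_sum]

theorem impulseCoeff_algebraMap (q : Polynomial ℝ) (k : ℕ) :
    impulseCoeff (algebraMap (Polynomial ℝ) (RatFunc ℝ) q) k = q.coeff k := by
  rw [← coeff_impulseSeries, impulseSeries_algebraMap, Polynomial.coeff_coe]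

theorem impulseCoeff_C (a : ℝ) (k : ℕ) :
    impulseCoeff (RatFunc.C a) k = if k = 0 then a else 0 := by
  rw [← RatFunc.algebraMap_C, impulseCoeff_algebraMap, Polynomial.coeff_C]

theorem impulseCoeff_X_mul_zero {g : RatFunc ℝ} (hg : g ∈ regularOn {0}) :
    impulseCoeff (RatFunc.X * g) 0 = 0 := by
  rw [impulseCoeff_mul_zero (X_mem_regularOn _) hg, ← RatFunc.algebraMap_X,
    impulseCoeff_algebraMap, Polynomial.coeff_X_zero, zero_mul]

theorem impulseCoeff_X_mul_succ {g : RatFunc ℝ} (hg : g ∈ regularOn {0}) (k : ℕ) :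
    impulseCoeff (RatFunc.X * g) (k + 1) = impulseCoeff g k := by
  rw [← coeff_impulseSeries, impulseSeries_mul (X_mem_regularOn _) hg, ← RatFunc.algebraMap_X,
    impulseSeries_algebraMap, Polynomial.coe_X, PowerSeries.coeff_succ_X_mul, coeff_impulseSeries]

/-- A causal rational function is determined by its impulse response. -/
theorem eq_of_impulseCoeff_eq {g h : RatFunc ℝ} (hg : g ∈ regularOn {0}) (hh : h ∈ regularOn {0})
    (H : ∀ k, impulseCoeff g k = impulseCoeff h k) : g = h := by
  have : impulseSeries g = impulseSeries h := by
    ext k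
    simp only [coeff_impulseSeries, H]
  have hinj : (g : LaurentSeries ℝ) = (h : LaurentSeries ℝ) → g = h :=
    fun e => RingHom.injective _ e
  apply hinj
  rw [← coe_impulseSeries hg, ← coe_impulseSeries hh, this]

/-- A stable rational function that vanishes at `z = ∞` is `z⁻¹` times a stable one. -/
theorem exists_eq_X_mul {g : RatFunc ℝ} (hg : g ∈ regularOn unitDisc)
    (h0 : impulseCoeff g 0 = 0) : ∃ h ∈ regularOn unitDisc, g = RatFunc.X * h := by
  have hnum : g.num.coeff 0 = 0 := by
    rw [← impulseCoeff_algebraMap]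
    rw [← mul_denom, impulseCoeff_mul_zero (unitDisc_regular_le hg) (algebraMap_mem_regularOn _ _), h0,
      zero_mul]
  obtain ⟨q, hq⟩ := Polynomial.X_dvd_iff.2 hnum
  refine ⟨algebraMap _ _ q / algebraMap _ _ g.denom,
    div_mem_regularOn q g.denom_ne_zero (mem_regularOn.1 hg), ?_⟩
  rw [← mul_div_assoc, ← RatFunc.algebraMap_X, ← map_mul, ← hq, RatFunc.num_div_denom]

theorem summable_norm_coeff_mul {φ ψ : PowerSeries ℂ}
    (hφ : Summable fun k => ‖PowerSeries.coeff k φ‖)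
    (hψ : Summable fun k => ‖PowerSeries.coeff k ψ‖) :
    Summable fun k => ‖PowerSeries.coeff k (φ * ψ)‖ := by
  simp only [PowerSeries.coeff_mul]
  exact summable_norm_sum_mul_antidiagonal_of_summable_norm
    (f := fun k => PowerSeries.coeff k φ) (g := fun k => PowerSeries.coeff k ψ) hφ hψ

theorem summable_norm_coeff_polynomial (q : Polynomial ℂ) :
    Summable fun k => ‖PowerSeries.coeff k (q : PowerSeries ℂ)‖ := by
  refine summable_of_ne_finset_zero (s := q.support) fun k hk => ?_
  rw [Polynomial.coeff_coe, Polynomial.notMem_support_iff.1 hk, norm_zero]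

/-- A product of linear factors with roots outside the closed unit disc has an absolutely summable
inverse, namely a product of geometric series. -/
theorem exists_summable_inverse (s : Multiset ℂ) (hs : ∀ r ∈ s, 1 < ‖r‖) :
    ∃ ψ : PowerSeries ℂ, (Summable fun k => ‖PowerSeries.coeff k ψ‖) ∧
      ψ * ((s.map fun r => Polynomial.X - Polynomial.C r).prod : Polynomial ℂ) = 1 := by
  induction s using Multiset.induction_on with
  | empty =>
    refine ⟨1, ?_, by simp⟩
    simpa using summable_norm_coeff_polynomial 1
  | cons r s ih =>
    obtain ⟨ψ, hψ, h1⟩ := ih fun x hx => hs x (Multiset.mem_cons_of_mem hx)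
    have hr : 1 < ‖r‖ := hs r (Multiset.mem_cons_self r s)
    have hr0 : r ≠ 0 := norm_pos_iff.1 (zero_lt_one.trans hr)
    let γ : PowerSeries ℂ := PowerSeries.mk fun k => -(r⁻¹) ^ (k + 1)
    have hγ : γ * ((Polynomial.X - Polynomial.C r : Polynomial ℂ) : PowerSeries ℂ) = 1 := by
      rw [Polynomial.coe_sub, Polynomial.coe_X, Polynomial.coe_C, mul_sub]
      ext k
      cases k with
      | zero => simp [γ, hr0]
      | succ k =>
        simp only [map_sub, PowerSeries.coeff_succ_mul_X, PowerSeries.coeff_mul_C, γ,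
          PowerSeries.coeff_mk, PowerSeries.coeff_one]
        rw [pow_succ _ (k + 1)]
        simp [hr0]
    refine ⟨γ * ψ, summable_norm_coeff_mul ?_ hψ, ?_⟩
    · have : ‖r⁻¹‖ < 1 := by
        rw [norm_inv]
        exact inv_lt_one_of_one_lt₀ hr
      simp only [γ, PowerSeries.coeff_mk, norm_neg, norm_pow]
      exact (summable_nat_add_iff 1).2 (summable_geometric_of_lt_one (norm_nonneg _) this)
    · rw [Multiset.map_cons, Multiset.prod_cons, Polynomial.coe_mul, mul_mul_mul_comm, hγ, h1,
        one_mul]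

/-- The impulse response of a stable rational function is absolutely summable. -/
theorem summable_norm_impulseCoeff {g : RatFunc ℝ} (hg : g ∈ regularOn unitDisc) :
    Summable fun k => ‖impulseCoeff g k‖ := by
  have hmul : impulseSeries g * (g.denom : PowerSeries ℝ) = g.num := by
    rw [← impulseSeries_algebraMap, ← impulseSeries_algebraMap, ← impulseSeries_mul
      (unitDisc_regular_le hg) (algebraMap_mem_regularOn _ _)]
    rw [mul_denom]
  set d := g.denom.map (algebraMap ℝ ℂ) with hd
  have hd0 : d ≠ 0 := (Polynomial.map_ne_zero_iff (algebraMap ℝ ℂ).injective).2 g.denom_ne_zero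
  have hroots : ∀ r ∈ d.roots, 1 < ‖r‖ := by
    intro r hr
    by_contra! hle
    refine hg r hle ?_
    have := (Polynomial.mem_roots hd0).1 hr
    rwa [Polynomial.IsRoot.def, hd, Polynomial.eval_map, ← Polynomial.aeval_def] at this
  obtain ⟨ψ, hψ, h1⟩ := exists_summable_inverse d.roots hroots
  have hfac : d = Polynomial.C d.leadingCoeff *
      (d.roots.map fun r => Polynomial.X - Polynomial.C r).prod :=
    (IsAlgClosed.splits d).eq_prod_roots
  have hlead : d.leadingCoeff ≠ 0 := Polynomial.leadingCoeff_ne_zero.2 hd0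
  have hmulC : PowerSeries.map (algebraMap ℝ ℂ) (impulseSeries g) * (d : PowerSeries ℂ)
      = ((g.num.map (algebraMap ℝ ℂ) : Polynomial ℂ) : PowerSeries ℂ) := by
    rw [hd, Polynomial.polynomial_map_coe, ← map_mul, hmul, Polynomial.polynomial_map_coe]
  have hinv : PowerSeries.map (algebraMap ℝ ℂ) (impulseSeries g) =
      ((g.num.map (algebraMap ℝ ℂ) * Polynomial.C d.leadingCoeff⁻¹ : Polynomial ℂ) :
        PowerSeries ℂ) * ψ := by
    have hunit : ((Polynomial.C d.leadingCoeff⁻¹ : Polynomial ℂ) : PowerSeries ℂ) * ψ *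
        (d : PowerSeries ℂ) = 1 := by
      rw [hfac, Polynomial.coe_mul, ← hfac, mul_mul_mul_comm, h1, mul_one, ← Polynomial.coe_mul,
        ← Polynomial.C_mul, inv_mul_cancel₀ hlead, Polynomial.C_1, Polynomial.coe_one]
    rw [Polynomial.coe_mul, ← hmulC, mul_assoc, mul_assoc, mul_comm (d : PowerSeries ℂ), hunit,
      mul_one]
  have := summable_norm_coeff_mul (summable_norm_coeff_polynomial
    (g.num.map (algebraMap ℝ ℂ) * Polynomial.C d.leadingCoeff⁻¹)) hψ
  rw [← hinv] at this
  simpa [PowerSeries.coeff_map, coeff_impulseSeries] using this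

/-! ### Stable filters acting on bounded sequences -/

section

variable {E : Type*} [NormedAddCommGroup E] [NormedSpace ℝ E]

/-- The response `∑ₖ gₖ x(t - k)` of the scalar filter `g = ∑ₖ gₖ z⁻ᵏ` to the sequence `x`. -/
noncomputable def scalarFilter (g : RatFunc ℝ) (x : ℤ → E) (t : ℤ) : E :=
  ∑' k : ℕ, impulseCoeff g k • x (t - k)

theorem summable_norm_scalarFilter {g : RatFunc ℝ} (hg : g ∈ regularOn unitDisc) {x : ℤ → E}
    {C : ℝ} (hx : ∀ t, ‖x t‖ ≤ C) (t : ℤ) :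
    Summable fun k : ℕ => ‖impulseCoeff g k • x (t - k)‖ := by
  refine .of_nonneg_of_le (fun _ => norm_nonneg _) (fun k => ?_)
    ((summable_norm_impulseCoeff hg).mul_right C)
  rw [norm_smul]
  gcongr
  exact hx _

theorem norm_scalarFilter_le {g : RatFunc ℝ} (hg : g ∈ regularOn unitDisc) {x : ℤ → E}
    {C : ℝ} (hx : ∀ t, ‖x t‖ ≤ C) (t : ℤ) :
    ‖scalarFilter g x t‖ ≤ (∑' k, ‖impulseCoeff g k‖) * C := by
  rw [← tsum_mul_right]
  refine (norm_tsum_le_tsum_norm (summable_norm_scalarFilter hg hx t)).trans ?_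
  refine (summable_norm_scalarFilter hg hx t).tsum_le_tsum (fun k => ?_)
    ((summable_norm_impulseCoeff hg).mul_right C)
  rw [norm_smul]
  gcongr
  exact hx _

theorem applyDelay_eq_scalarFilter {Ω : Type*} [MeasurableSpace Ω] {μ : Measure Ω}
    (q : Polynomial ℝ) (x : ℤ → Lp ℝ 2 μ) (t : ℤ) :
    applyDelay q x t = scalarFilter (algebraMap (Polynomial ℝ) (RatFunc ℝ) q) x t := by
  simp only [applyDelay, scalarFilter, Polynomial.sum_def, impulseCoeff_algebraMap]
  refine (tsum_eq_sum fun k hk => ?_).symm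
  rw [Polynomial.notMem_support_iff.1 hk, zero_smul]

variable [CompleteSpace E]

theorem hasSum_scalarFilter {g : RatFunc ℝ} (hg : g ∈ regularOn unitDisc) {x : ℤ → E}
    {C : ℝ} (hx : ∀ t, ‖x t‖ ≤ C) (t : ℤ) :
    HasSum (fun k : ℕ => impulseCoeff g k • x (t - k)) (scalarFilter g x t) :=
  (summable_norm_scalarFilter hg hx t).of_norm.hasSum

theorem scalarFilter_sum_left {κ : Type*} (s : Finset κ) {g : κ → RatFunc ℝ}
    (hg : ∀ j, g j ∈ regularOn unitDisc) {x : ℤ → E} {C : ℝ} (hx : ∀ t, ‖x t‖ ≤ C) (t : ℤ) :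
    scalarFilter (∑ j ∈ s, g j) x t = ∑ j ∈ s, scalarFilter (g j) x t := by
  refine HasSum.tsum_eq ?_
  simp only [impulseCoeff_sum, Finset.sum_smul]
  exact hasSum_sum fun j _ => hasSum_scalarFilter (hg j) hx t

theorem scalarFilter_sum_right {κ : Type*} (s : Finset κ) {g : RatFunc ℝ}
    (hg : g ∈ regularOn unitDisc) {x : κ → ℤ → E} {C : κ → ℝ} (hx : ∀ j t, ‖x j t‖ ≤ C j) (t : ℤ) :
    scalarFilter g (fun t => ∑ j ∈ s, x j t) t = ∑ j ∈ s, scalarFilter g (x j) t := by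
  refine HasSum.tsum_eq ?_
  simp only [Finset.smul_sum]
  exact hasSum_sum fun j _ => hasSum_scalarFilter hg (hx j) t

/-- A product of stable filters acts as the composition: the double series converges absolutely,
so that it can be summed along the antidiagonals. -/
theorem scalarFilter_mul {g h : RatFunc ℝ} (hg : g ∈ regularOn unitDisc)
    (hh : h ∈ regularOn unitDisc) {x : ℤ → E} {C : ℝ} (hx : ∀ t, ‖x t‖ ≤ C) (t : ℤ) :
    scalarFilter (g * h) x t = scalarFilter g (scalarFilter h x) t := by
  have hC : 0 ≤ C := (norm_nonneg _).trans (hx 0)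
  let f : ℕ × ℕ → E := fun q => impulseCoeff g q.1 • impulseCoeff h q.2 • x (t - q.1 - q.2)
  have hf : Summable f := by
    have h2 := ((summable_norm_impulseCoeff hg).mul_of_nonneg (summable_norm_impulseCoeff hh)
      (fun _ => norm_nonneg _) (fun _ => norm_nonneg _)).mul_right C
    refine .of_norm_bounded h2 fun q => ?_
    simp only [f, norm_smul, ← mul_assoc]
    gcongr
    exact hx _
  have h1 : HasSum f (scalarFilter g (scalarFilter h x) t) := by
    have hrow (k : ℕ) : HasSum (fun l => f (k, l))
        (impulseCoeff g k • scalarFilter h x (t - k)) :=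
      (hasSum_scalarFilter hh hx (t - k)).const_smul _
    have : scalarFilter g (scalarFilter h x) t = ∑' q, f q :=
      (hf.hasSum.prod_fiberwise hrow).tsum_eq
    rw [this]
    exact hf.hasSum
  rw [← Finset.HasAntidiagonal.sigmaAntidiagonalEquivProd.hasSum_iff] at h1
  refine HasSum.tsum_eq (h1.sigma fun k => ?_)
  convert hasSum_fintype _ using 1
  rw [impulseCoeff_mul (unitDisc_regular_le hg) (unitDisc_regular_le hh), Finset.sum_smul,
    ← Finset.sum_coe_sort]
  refine Finset.sum_congr rfl fun q _ => ?_
  have hq : (q : ℕ × ℕ).1 + (q : ℕ × ℕ).2 = k := Finset.HasAntidiagonal.mem_antidiagonal.1 q.2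
  simp only [f, Function.comp, Finset.HasAntidiagonal.sigmaAntidiagonalEquivProd_apply, mul_smul,
    ← hq, Nat.cast_add, sub_sub]

end

/-! ### Filter responses and transfer relations -/

section

variable {Ω : Type*} [MeasurableSpace Ω] {μ : Measure Ω} {ι κ l : Type*}

theorem isFilterResponse_iff [Fintype κ] {G : Matrix ι κ (RatFunc ℝ)} (hG : IsStableTF G)
    {u : RandProc κ μ} {C : ℝ} (hu : ∀ t j, ‖u t j‖ ≤ C) {y : RandProc ι μ} :
    IsFilterResponse G u y ↔
      ∀ t i, y t i = ∑ j, scalarFilter (G i j) (fun s => u s j) t := by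
  have key (t : ℤ) (i : ι) := hasSum_sum (s := Finset.univ) fun (j : κ) _ =>
    hasSum_scalarFilter (hG i j) (fun s => hu s j) t
  exact ⟨fun h t i => (h t i).unique (key t i), fun h t i => by rw [h t i]; exact key t i⟩

theorem IsFilterResponse.exists_norm_le [Fintype κ] [Finite ι] {G : Matrix ι κ (RatFunc ℝ)}
    (hG : IsStableTF G) {u : RandProc κ μ} {C : ℝ} (hu : ∀ t j, ‖u t j‖ ≤ C) {y : RandProc ι μ}
    (h : IsFilterResponse G u y) : ∃ C', ∀ t i, ‖y t i‖ ≤ C' := by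
  have := Fintype.ofFinite ι
  have hb (i : ι) (t : ℤ) : ‖y t i‖ ≤ ∑ j, (∑' k, ‖impulseCoeff (G i j) k‖) * C := by
    rw [(isFilterResponse_iff hG hu).1 h t i]
    exact norm_sum_le_of_le _ fun j _ => norm_scalarFilter_le (hG i j) (fun s => hu s j) t
  refine ⟨∑ i, |∑ j, (∑' k, ‖impulseCoeff (G i j) k‖) * C|, fun t i => ?_⟩
  exact ((hb i t).trans (le_abs_self _)).trans
    (Finset.single_le_sum (f := fun i => |∑ j, (∑' k, ‖impulseCoeff (G i j) k‖) * C|)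
      (fun _ _ => abs_nonneg _) (Finset.mem_univ i))

/-- Filtering the response of `H` by `G` is filtering by `G * H`. -/
theorem IsFilterResponse.comp_iff [Fintype κ] [Fintype l] {G : Matrix ι κ (RatFunc ℝ)}
    {H : Matrix κ l (RatFunc ℝ)} (hG : IsStableTF G) (hH : IsStableTF H) {u : RandProc l μ}
    {C : ℝ} (hu : ∀ t j, ‖u t j‖ ≤ C) {x : RandProc κ μ} (hx : IsFilterResponse H u x)
    {y : RandProc ι μ} : IsFilterResponse G x y ↔ IsFilterResponse (G * H) u y := by
  obtain ⟨C', hC'⟩ := hx.exists_norm_le hH hu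
  rw [isFilterResponse_iff hG hC', isFilterResponse_iff (hG.mul hH) hu]
  rw [isFilterResponse_iff hH hu] at hx
  refine forall_congr' fun t => forall_congr' fun i => ?_
  have : ∑ j, scalarFilter (G i j) (fun s => x s j) t =
      ∑ k, scalarFilter ((G * H) i k) (fun s => u s k) t := by
    have h1 (k : l) : scalarFilter ((G * H) i k) (fun s => u s k) t =
        ∑ j, scalarFilter (G i j) (scalarFilter (H j k) fun s => u s k) t := by
      rw [Matrix.mul_apply, scalarFilter_sum_left _
        (fun j => Subring.mul_mem _ (hG i j) (hH j k)) (fun s => hu s k)]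
      exact Finset.sum_congr rfl fun j _ =>
        scalarFilter_mul (hG i j) (hH j k) (fun s => hu s k) t
    simp only [h1]
    rw [Finset.sum_comm]
    refine Finset.sum_congr rfl fun j _ => ?_
    simp only [hx]
    exact scalarFilter_sum_right _ (hG i j)
      (fun k s => norm_scalarFilter_le (hH j k) (fun s => hu s k) s) t
  rw [this]

theorem IsFilterResponse.sub [Fintype κ] {G H : Matrix ι κ (RatFunc ℝ)} {u : RandProc κ μ}
    {x y : RandProc ι μ} (hx : IsFilterResponse G u x) (hy : IsFilterResponse H u y) :
    IsFilterResponse (G - H) u fun t i => x t i - y t i := by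
  intro t i
  simpa only [Matrix.sub_apply, impulseCoeff_sub, sub_smul, Finset.sum_sub_distrib]
    using (hx t i).sub (hy t i)

theorem isFilterResponse_constTF_iff [Fintype κ] {K : Matrix ι κ ℝ} {u : RandProc κ μ}
    {y : RandProc ι μ} :
    IsFilterResponse (constTF K) u y ↔ ∀ t i, y t i = ∑ j, K i j • u t j := by
  have key (t : ℤ) (i : ι) : HasSum (fun k : ℕ =>
      ∑ j, impulseCoeff (constTF K i j) k • u (t - k) j) (∑ j, K i j • u t j) := by
    convert hasSum_single 0 fun k hk => ?_ using 1
    · simp [constTF, impulseCoeff_C]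
    · simp [constTF, impulseCoeff_C, hk]
  exact ⟨fun h t i => (h t i).unique (key t i), fun h t i => by rw [h t i]; exact key t i⟩

/-- The response of `z⁻¹ G` is the response of `G` to the delayed input. -/
theorem IsFilterResponse.delay [Fintype κ] {G : Matrix ι κ (RatFunc ℝ)} (hG : IsCausalTF G)
    {u : RandProc κ μ} {y : RandProc ι μ}
    (h : IsFilterResponse ((RatFunc.X : RatFunc ℝ) • G) u y) :
    IsFilterResponse G (fun t => u (t - 1)) y := by
  intro t i
  have hG' := isCausalTF_iff.1 hG
  have := (hasSum_nat_add_iff' 1).2 (h t i)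
  simpa only [Matrix.smul_apply, smul_eq_mul, impulseCoeff_X_mul_succ (hG' i _),
    Finset.sum_range_one, impulseCoeff_X_mul_zero (hG' i _), zero_smul, Finset.sum_const_zero,
    sub_zero, Nat.cast_add, Nat.cast_one, sub_add_eq_sub_sub] using this

theorem IsFilterResponse.shift [Fintype κ] {G : Matrix ι κ (RatFunc ℝ)}
    {u : RandProc κ μ} {y : RandProc ι μ} (h : IsFilterResponse G u y) (s : ℤ) :
    IsFilterResponse G (fun t => u (t - s)) (fun t => y (t - s)) := by
  intro t i
  simpa only [sub_right_comm] using h (t - s) i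

/-- If `u = B e`, the difference equations `d y = N u` say that `d y` is the response of `N B`
to `e`. -/
theorem transferRelation_fraction_iff [Fintype κ] [Fintype l] {d : Polynomial ℝ}
    {N : Matrix ι κ (Polynomial ℝ)} {B : Matrix κ l (RatFunc ℝ)}
    (hB : IsStableTF B) {e : RandProc l μ} {C : ℝ} (he : ∀ t j, ‖e t j‖ ≤ C)
    {u : RandProc κ μ} {y : RandProc ι μ} (hu : IsFilterResponse B e u) :
    (∀ t i, applyDelay d (fun s => y s i) t = ∑ j, applyDelay (N i j) (fun s => u s j) t) ↔
    IsFilterResponse (N.map (algebraMap (Polynomial ℝ) (RatFunc ℝ)) * B) e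
      (fun t i => applyDelay d (fun s => y s i) t) := by
  obtain ⟨C', hC'⟩ := hu.exists_norm_le hB he
  rw [← IsFilterResponse.comp_iff (isStableTF_map_algebraMap N) hB he hu,
    isFilterResponse_iff (isStableTF_map_algebraMap N) hC']
  simp only [applyDelay_eq_scalarFilter, Matrix.map_apply]

theorem isFilterResponse_applyDelay [Fintype l] (d : Polynomial ℝ)
    {A : Matrix ι l (RatFunc ℝ)} (hA : IsStableTF A) {e : RandProc l μ} {C : ℝ}
    (he : ∀ t j, ‖e t j‖ ≤ C) {y : RandProc ι μ} (hy : IsFilterResponse A e y) :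
    IsFilterResponse (algebraMap (Polynomial ℝ) (RatFunc ℝ) d • A) e
      (fun t i => applyDelay d (fun s => y s i) t) := by
  have hd := algebraMap_mem_regularOn unitDisc d
  rw [isFilterResponse_iff (hA.smul hd) he]
  intro t i
  rw [isFilterResponse_iff hA he] at hy
  simp only [applyDelay_eq_scalarFilter, hy, Matrix.smul_apply, smul_eq_mul]
  rw [scalarFilter_sum_right _ hd
    (fun k s => norm_scalarFilter_le (hA i k) (fun s => he s k) s) t]
  exact Finset.sum_congr rfl fun j _ => (scalarFilter_mul hd (hA i j) (fun s => he s j) t).symm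

end

/-! ### Responses to a normalized white noise -/

section

variable {Ω : Type*} [MeasurableSpace Ω] {μ : Measure Ω} {ι κ l : Type*} [DecidableEq l]

theorem IsNormalizedWhiteNoise.norm_le {e : RandProc l μ} (he : IsNormalizedWhiteNoise e)
    (t : ℤ) (j : l) : ‖e t j‖ ≤ 1 := by
  have := he.2 t t j j
  rw [real_inner_self_eq_norm_sq] at this
  simp only [and_self, if_true] at this
  nlinarith [norm_nonneg (e t j)]

variable [Fintype l]

/-- The impulse response is the cross-covariance of the response with the white noise input. -/
theorem IsFilterResponse.inner_past {e : RandProc l μ} (he : IsNormalizedWhiteNoise e)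
    {A : Matrix ι l (RatFunc ℝ)} {y : RandProc ι μ} (h : IsFilterResponse A e y)
    (t : ℤ) (i : ι) (k : ℕ) (j : l) :
    inner ℝ (y t i) (e (t - k) j) = impulseCoeff (A i j) k := by
  have h1 := (h t i).mapL (innerSL ℝ (e (t - k) j))
  have h2 : HasSum (fun n : ℕ => innerSL ℝ (e (t - k) j)
      (∑ j', impulseCoeff (A i j') n • e (t - n) j')) (impulseCoeff (A i j) k) := by
    convert hasSum_single k fun n hn => ?_ using 1
    · simp [he.2]
    · have : ¬ ((k : ℤ) = n) := by exact_mod_cast hn.symm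
      simp [he.2, this]
  rw [real_inner_comm, ← innerSL_apply_apply]
  exact h1.unique h2

theorem IsFilterResponse.inner_future {e : RandProc l μ} (he : IsNormalizedWhiteNoise e)
    {A : Matrix ι l (RatFunc ℝ)} {y : RandProc ι μ} (h : IsFilterResponse A e y)
    {t s : ℤ} (hts : t < s) (i : ι) (j : l) : inner ℝ (e s j) (y t i) = 0 := by
  have h1 := (h t i).mapL (innerSL ℝ (e s j))
  rw [← innerSL_apply_apply]
  refine h1.unique ?_
  convert hasSum_zero using 2 with n
  have : s ≠ t - n := by omega
  simp [he.2, this]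

/-- A causal transfer matrix is determined by its response to a normalized white noise. -/
theorem IsFilterResponse.unique_matrix {e : RandProc l μ} (he : IsNormalizedWhiteNoise e)
    {A B : Matrix ι l (RatFunc ℝ)} (hA : IsCausalTF A) (hB : IsCausalTF B) {y : RandProc ι μ}
    (h : IsFilterResponse A e y) (h' : IsFilterResponse B e y) : A = B := by
  ext1 i j
  refine eq_of_impulseCoeff_eq (isCausalTF_iff.1 hA i j) (isCausalTF_iff.1 hB i j) fun k => ?_
  rw [← h.inner_past he 0 i k j, ← h'.inner_past he 0 i k j]

/-- For the responses `u = B e`, `y = A e` to a normalized white noise, the relation `y = G u`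
holds exactly if `A = G B`, even if `G` is not stable. -/
theorem isTransferRelation_iff [Finite ι] [Fintype κ] {e : RandProc l μ}
    (he : IsNormalizedWhiteNoise e) {G : Matrix ι κ (RatFunc ℝ)} {A : Matrix ι l (RatFunc ℝ)}
    {B : Matrix κ l (RatFunc ℝ)} (hA : IsStableTF A) (hB : IsStableTF B)
    {u : RandProc κ μ} {y : RandProc ι μ} (hu : IsFilterResponse B e u)
    (hy : IsFilterResponse A e y) : IsTransferRelation G u y ↔ A = G * B := by
  have hfrac {d : Polynomial ℝ} {N : Matrix ι κ (Polynomial ℝ)}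
      (hN : ∀ i j, algebraMap (Polynomial ℝ) (RatFunc ℝ) d * G i j
        = algebraMap (Polynomial ℝ) (RatFunc ℝ) (N i j)) :
      N.map (algebraMap (Polynomial ℝ) (RatFunc ℝ)) * B =
        algebraMap (Polynomial ℝ) (RatFunc ℝ) d • (G * B) := by
    rw [← Matrix.smul_mul]
    congr 1
    ext1 i j
    exact (hN i j).symm
  have hd (d : Polynomial ℝ) := isFilterResponse_applyDelay d hA he.norm_le hy
  constructor
  · intro h
    obtain ⟨b, hb⟩ := IsLocalization.exist_integer_multiples_of_finite
      (nonZeroDivisors (Polynomial ℝ)) (fun q : ι × κ => G q.1 q.2)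
    choose N hN using hb
    have hb0 : (b : Polynomial ℝ) ≠ 0 := nonZeroDivisors.ne_zero b.2
    have hN' (i : ι) (j : κ) : algebraMap (Polynomial ℝ) (RatFunc ℝ) b * G i j
        = algebraMap (Polynomial ℝ) (RatFunc ℝ) (N (i, j)) := by
      rw [hN (i, j), Algebra.smul_def]
    have h1 := (transferRelation_fraction_iff hB he.norm_le hu).1
      (h b (fun i j => N (i, j)) hb0 hN')
    have h2 := (hd b).unique_matrix he
      (hA.smul (algebraMap_mem_regularOn _ _)).isCausalTF
      ((isStableTF_map_algebraMap _).mul hB).isCausalTF h1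
    rw [hfrac hN'] at h2
    exact smul_right_injective _ (RatFunc.algebraMap_ne_zero hb0) h2
  · rintro rfl d N - hN
    refine (transferRelation_fraction_iff hB he.norm_le hu).2 ?_
    rw [hfrac hN]
    exact hd d

end

/-! ### Past spaces -/

section

variable {Ω : Type*} [MeasurableSpace Ω] {μ : Measure Ω} {ι κ : Type*}

theorem pastSpace_mono (y : RandProc ι μ) {s t : ℤ} (h : s ≤ t) :
    pastSpace y s ≤ pastSpace y t := by
  refine Submodule.topologicalClosure_mono (Submodule.span_mono ?_)
  rintro x ⟨r, hr, i, rfl⟩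
  exact ⟨r, hr.trans h, i, rfl⟩

theorem pastSpace_le {y : RandProc ι μ} {t : ℤ} {V : Submodule ℝ (Lp ℝ 2 μ)}
    (hV : IsClosed (V : Set (Lp ℝ 2 μ))) (h : ∀ s ≤ t, ∀ i, y s i ∈ V) : pastSpace y t ≤ V := by
  refine Submodule.topologicalClosure_minimal _ (Submodule.span_le.2 ?_) hV
  rintro x ⟨s, hs, i, rfl⟩
  exact h s hs i

theorem isClosed_pastSpace (y : RandProc ι μ) (t : ℤ) :
    IsClosed (pastSpace y t : Set (Lp ℝ 2 μ)) :=
  Submodule.isClosed_topologicalClosure _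

/-- The response of a causal filter lies in the past space of the input. -/
theorem IsFilterResponse.mem_pastSpace [Fintype κ] {A : Matrix ι κ (RatFunc ℝ)} {u : RandProc κ μ}
    {y : RandProc ι μ} (h : IsFilterResponse A u y) (t : ℤ) (i : ι) :
    y t i ∈ pastSpace u t := by
  refine (Submodule.isClosed_topologicalClosure _).mem_of_tendsto (h t i)
    (Filter.Eventually.of_forall fun s => ?_)
  refine Submodule.sum_mem _ fun k _ => Submodule.sum_mem _ fun j _ => Submodule.smul_mem _ _ ?_
  exact Submodule.le_topologicalClosure _ (Submodule.subset_span ⟨t - k, by omega, j, rfl⟩)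

theorem IsFilterResponse.pastSpace_le [Fintype κ] {A : Matrix ι κ (RatFunc ℝ)}
    {u : RandProc κ μ} {y : RandProc ι μ} (h : IsFilterResponse A u y) (t : ℤ) :
    pastSpace y t ≤ pastSpace u t :=
  _root_.pastSpace_le (isClosed_pastSpace u t) fun s hs i =>
    pastSpace_mono u hs (h.mem_pastSpace s i)

/-- A vector orthogonal to the generators of a past space is orthogonal to the past space. -/
theorem inner_eq_zero_of_mem_pastSpace {y : RandProc ι μ} {t : ℤ} {w x : Lp ℝ 2 μ}
    (h : ∀ s ≤ t, ∀ i, inner ℝ w (y s i) = 0) (hx : x ∈ pastSpace y t) : inner ℝ w x = 0 := by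
  have : pastSpace y t ≤ (Submodule.span ℝ {w})ᗮ :=
    pastSpace_le (Submodule.isClosed_orthogonal _) fun s hs i =>
      Submodule.mem_orthogonal_singleton_iff_inner_right.2 (h s hs i)
  exact Submodule.mem_orthogonal_singleton_iff_inner_right.1 (this hx)

/-! ### Feedthrough matrices -/

/-- The value `G(∞)` of a causal transfer matrix. -/
noncomputable def feedthrough (G : Matrix ι κ (RatFunc ℝ)) : Matrix ι κ ℝ :=
  G.map fun g => impulseCoeff g 0

theorem feedthrough_mul {l : Type*} [Fintype κ] {G : Matrix ι κ (RatFunc ℝ)}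
    {H : Matrix κ l (RatFunc ℝ)} (hG : IsCausalTF G) (hH : IsCausalTF H) :
    feedthrough (G * H) = feedthrough G * feedthrough H := by
  ext i j
  simp only [feedthrough, Matrix.map_apply, Matrix.mul_apply, impulseCoeff_sum]
  exact Finset.sum_congr rfl fun k _ =>
    impulseCoeff_mul_zero (isCausalTF_iff.1 hG i k) (isCausalTF_iff.1 hH k j)

theorem feedthrough_constTF (K : Matrix ι κ ℝ) : feedthrough (constTF K) = K := by
  ext i j
  simp [feedthrough, constTF, impulseCoeff_C]

theorem feedthrough_sub (G H : Matrix ι κ (RatFunc ℝ)) :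
    feedthrough (G - H) = feedthrough G - feedthrough H := by
  ext i j
  simp [feedthrough, impulseCoeff_sub]

theorem constTF_mul {l : Type*} [Fintype κ] (K : Matrix ι κ ℝ) (L : Matrix κ l ℝ) :
    constTF (K * L) = constTF K * constTF L :=
  Matrix.map_mul (f := (RatFunc.C : ℝ →+* RatFunc ℝ))

theorem constTF_one [DecidableEq ι] : constTF (1 : Matrix ι ι ℝ) = 1 :=
  Matrix.map_one (RatFunc.C : ℝ →+* RatFunc ℝ) (map_zero _) (map_one _)

theorem feedthrough_one [DecidableEq ι] : feedthrough (1 : Matrix ι ι (RatFunc ℝ)) = 1 := by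
  rw [← constTF_one, feedthrough_constTF]

theorem IsStrictlyCausalTF.feedthrough_eq_zero {G : Matrix ι κ (RatFunc ℝ)}
    (hG : IsStrictlyCausalTF G) : feedthrough G = 0 := by
  obtain ⟨G', hG', rfl⟩ := hG
  ext i j
  exact impulseCoeff_X_mul_zero (isCausalTF_iff.1 hG' i j)

theorem exists_eq_X_smul {G : Matrix ι κ (RatFunc ℝ)} (hG : IsStableTF G)
    (h : feedthrough G = 0) :
    ∃ M : Matrix ι κ (RatFunc ℝ), IsStableTF M ∧ G = (RatFunc.X : RatFunc ℝ) • M := by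
  choose M hM hGM using fun i j => exists_eq_X_mul (hG i j) (congr_fun (congr_fun h i) j)
  exact ⟨M, hM, by ext1 i j; exact hGM i j⟩

theorem isMinimumPhase_constTF [Fintype ι] [DecidableEq ι] {K : Matrix ι ι ℝ} (hK : IsUnit K) :
    IsMinimumPhase (constTF K) := by
  refine ⟨isStableTF_constTF K, fun ζ _ => Matrix.mulVec_injective_of_isUnit ?_⟩
  have : evalTF (constTF K) ζ = (algebraMap ℝ ℂ).mapMatrix K := by
    ext i j
    simp [evalTF, constTF]
  rw [this]
  exact hK.map _

/-! ### Prediction from the past of a white noise -/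

/-- The one step prediction of the response to a white noise `e` from the strict past of `e`:
the prediction error is the feedthrough term. -/
theorem sub_wienerPredictor_eq [Fintype κ] [DecidableEq κ] {e : RandProc κ μ}
    (he : IsNormalizedWhiteNoise e) {W : Matrix ι κ (RatFunc ℝ)} (hW : IsStableTF W)
    {y : RandProc ι μ} (hy : IsFilterResponse W e y) {ι' : Type*} {x : RandProc ι' μ}
    (hx : ∀ t, pastSpace x t = pastSpace e t) (t : ℤ) (i : ι) :
    y t i - wienerPredictor y x t i = ∑ j, feedthrough W i j • e t j := by
  have hK : IsFilterResponse (constTF (feedthrough W)) e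
      (fun t i => ∑ j, feedthrough W i j • e t j) :=
    isFilterResponse_constTF_iff.2 fun _ _ => rfl
  obtain ⟨M, hM, hWM⟩ := exists_eq_X_smul (hW.sub (isStableTF_constTF (feedthrough W)))
    (by rw [feedthrough_sub, feedthrough_constTF, sub_self])
  have hdiff := hy.sub hK
  rw [hWM] at hdiff
  have hmem := (hdiff.delay hM.isCausalTF).mem_pastSpace t i
  have hshift : pastSpace (fun t => e (t - 1)) t ≤ pastSpace e (t - 1) :=
    pastSpace_le (isClosed_pastSpace _ _) fun s hs j =>
      Submodule.le_topologicalClosure _ (Submodule.subset_span ⟨s - 1, by omega, j, rfl⟩)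
  have horth : ∀ z ∈ pastSpace x (t - 1),
      inner ℝ (y t i - (y t i - ∑ j, feedthrough W i j • e t j)) z = 0 := by
    intro z hz
    rw [hx] at hz
    refine inner_eq_zero_of_mem_pastSpace (fun s hs j => ?_) hz
    have : t ≠ s := by omega
    simp [sum_inner, inner_smul_left, he.2, this]
  have hproj := Submodule.eq_starProjection_of_mem_of_inner_eq_zero (K := pastSpace x (t - 1))
    (by rw [hx]; exact hshift hmem) horth
  rw [wienerPredictor, hproj, sub_sub_cancel]

end

/-! ### The predictor as a feedback representation -/

section

variable {Ω : Type*} [MeasurableSpace Ω] {μ : Measure Ω} {ι κ : Type*} [Fintype ι] [Fintype κ]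
  [DecidableEq ι] [DecidableEq κ]

/-- If `W₁ = F W₂ + K` with `K` invertible, the loop closed by `F` and `H = W₂ W₁⁻¹` has return
difference `1 - F H = K W₁⁻¹`; its closed loop transfer functions are polynomial in the stable
matrices `W₁`, `W₂`, `F` and `K⁻¹`. -/
theorem isInternallyStable_of_eq {W₁ : Matrix ι ι (RatFunc ℝ)} {W₂ : Matrix κ ι (RatFunc ℝ)}
    {F : Matrix ι κ (RatFunc ℝ)} {K : Matrix ι ι ℝ} (hst₁ : IsStableTF W₁) (hst₂ : IsStableTF W₂)
    (hF : IsStableTF F) (hdet : W₁.det ≠ 0) (hK : IsUnit K) (h : W₁ = F * W₂ + constTF K) :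
    IsInternallyStable F (W₂ * W₁⁻¹) := by
  set P := constTF K with hP
  set Q := constTF K⁻¹ with hQ
  set H := W₂ * W₁⁻¹ with hH
  have hKdet : IsUnit K.det := (Matrix.isUnit_iff_isUnit_det K).1 hK
  have hPQ : P * Q = 1 := by
    rw [hP, hQ, ← constTF_mul, Matrix.mul_nonsing_inv K hKdet, constTF_one]
  have hQst : IsStableTF Q := isStableTF_constTF _
  have hinv : W₁ * W₁⁻¹ = 1 := Matrix.mul_nonsing_inv _ hdet.isUnit
  have hinv' : W₁⁻¹ * W₁ = 1 := Matrix.nonsing_inv_mul _ hdet.isUnit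
  have hHW : H * W₁ = W₂ := by rw [hH, Matrix.mul_assoc, hinv', Matrix.mul_one]
  have hFW : F * W₂ = W₁ - P := by rw [h, add_sub_cancel_right]
  have hFH : F * H = 1 - P * W₁⁻¹ := by
    rw [hH, ← Matrix.mul_assoc, hFW, Matrix.sub_mul, hinv]
  have e1 : (1 - F * H) * (W₁ * Q) = 1 := by
    rw [hFH, sub_sub_cancel, Matrix.mul_assoc, ← Matrix.mul_assoc _ W₁, hinv', Matrix.one_mul, hPQ]
  have e2 : (1 - H * F) * (1 + W₂ * Q * F) = 1 := by
    have h3 : H * F * (W₂ * Q * F) = W₂ * Q * F - H * F := by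
      calc H * F * (W₂ * Q * F) = H * (F * W₂) * Q * F := by simp only [Matrix.mul_assoc]
        _ = H * W₁ * Q * F - H * (P * Q) * F := by
          rw [hFW]
          simp only [Matrix.mul_sub, Matrix.sub_mul, Matrix.mul_assoc]
        _ = W₂ * Q * F - H * F := by rw [hHW, hPQ, Matrix.mul_one]
    rw [Matrix.sub_mul, Matrix.one_mul, Matrix.mul_add, Matrix.mul_one, h3]
    abel
  have e3 : (1 + W₂ * Q * F) * H = W₂ * Q := by
    have hQP : Q * P = 1 := mul_eq_one_comm.1 hPQ
    calc (1 + W₂ * Q * F) * H = H + W₂ * Q * (F * H) := by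
          rw [Matrix.add_mul, Matrix.one_mul, Matrix.mul_assoc]
      _ = H + (W₂ * Q - W₂ * (Q * P) * W₁⁻¹) := by
          rw [hFH, Matrix.mul_sub, Matrix.mul_one]
          simp only [Matrix.mul_assoc]
      _ = W₂ * Q := by rw [hQP, Matrix.mul_one, ← hH]; abel
  have hst3 : IsStableTF (1 + W₂ * Q * F) := isStableTF_one.add ((hst₂.mul hQst).mul hF)
  refine ⟨.of_mul_eq_one _ e1, .of_mul_eq_one _ e2, ?_⟩
  rw [Matrix.inv_eq_right_inv e1, Matrix.inv_eq_right_inv e2, e3]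
  exact ⟨hst₁.mul hQst, (hst₁.mul hQst).mul hF, hst₂.mul hQst, hst3⟩

/-- In a feedback representation of `y₁ = W₁ e`, `y₂ = W₂ e`, the relations between the processes
are identities between transfer matrices. -/
theorem IsFeedbackRepresentation.transfer_eq {e : RandProc ι μ} (he : IsNormalizedWhiteNoise e)
    {W₁ : Matrix ι ι (RatFunc ℝ)} {W₂ : Matrix κ ι (RatFunc ℝ)} {y₁ : RandProc ι μ}
    {y₂ : RandProc κ μ} (hst₁ : IsStableTF W₁) (hst₂ : IsStableTF W₂)
    (hy₁ : IsFilterResponse W₁ e y₁) (hy₂ : IsFilterResponse W₂ e y₂)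
    {F : Matrix ι κ (RatFunc ℝ)} {H : Matrix κ ι (RatFunc ℝ)} {K : Matrix ι ι (RatFunc ℝ)}
    {w : RandProc ι μ} (h : IsFeedbackRepresentation F H K e y₁ y₂ w) :
    W₁ - K = F * W₂ ∧ W₂ = H * W₁ := by
  refine ⟨(isTransferRelation_iff he (hst₁.sub h.stable_K) hst₂ hy₂ (hy₁.sub h.noise)).1
    h.model.forward, (isTransferRelation_iff he hst₂ hst₁ hy₁ hy₂).1 ?_⟩
  simpa using h.model.feedback

end

section

variable {Ω : Type*} [MeasurableSpace Ω] {μ : Measure Ω} {ι κ : Type*} [Fintype ι]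
  [DecidableEq ι]

/-! ### Stationarity of the noise -/

/-- The square integrable random variables of mean zero. -/
def zeroMeanSubmodule (μ : Measure Ω) [IsProbabilityMeasure μ] : Submodule ℝ (Lp ℝ 2 μ) where
  carrier := {f | ∫ ω, (f : Ω → ℝ) ω ∂μ = 0}
  zero_mem' := by
    rw [Set.mem_ofPred_eq, integral_congr_ae (Lp.coeFn_zero ℝ 2 μ)]
    simp
  add_mem' := by
    intro f g hf hg
    rw [Set.mem_ofPred_eq] at hf hg ⊢
    rw [integral_congr_ae (Lp.coeFn_add f g)]
    simp only [Pi.add_apply]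
    rw [integral_add ((Lp.memLp f).integrable one_le_two)
      ((Lp.memLp g).integrable one_le_two), hf, hg, add_zero]
  smul_mem' := by
    intro c f hf
    rw [Set.mem_ofPred_eq] at hf ⊢
    rw [integral_congr_ae (Lp.coeFn_smul c f)]
    simp only [Pi.smul_apply]
    rw [integral_smul, hf, smul_zero]

/-- The noise of the predictor representation is wide sense stationary, jointly with the zero
modeling error. -/
theorem isWideSenseStationary_noise [IsProbabilityMeasure μ] {e : RandProc ι μ}
    (he : IsNormalizedWhiteNoise e)
    (K : Matrix ι ι ℝ) :
    IsWideSenseStationary (jointProcess (fun t i => ∑ j, K i j • e t j) (0 : RandProc κ μ)) := by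
  refine ⟨?_, ?_⟩
  · rintro t (i | i)
    · exact Submodule.sum_mem (zeroMeanSubmodule μ) fun j _ =>
        Submodule.smul_mem _ _ (he.1 t j)
    · exact Submodule.zero_mem (zeroMeanSubmodule μ)
  · rintro h t s (i | i) (j | j)
    · simp [jointProcess, sum_inner, inner_sum, inner_smul_left, inner_smul_right, he.2]
    · simp [jointProcess]
    · simp [jointProcess]
    · simp [jointProcess]

end

/-! ### Existence and uniqueness of the predictor representation -/

theorem mainTheorem2 {Ω : Type*} [MeasurableSpace Ω] (μ : Measure Ω) [IsProbabilityMeasure μ]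
    (m p : ℕ)
    (y₁ : RandProc (Fin m) μ) (y₂ : RandProc (Fin p) μ) (e : RandProc (Fin m) μ)
    (W₁ : Matrix (Fin m) (Fin m) (RatFunc ℝ)) (W₂ : Matrix (Fin p) (Fin m) (RatFunc ℝ))
    (hW : IsInnovationRepresentation (Matrix.fromRows W₁ W₂) e (jointProcess y₁ y₂))
    (hW₁ : W₁.det ≠ 0)
    (hH : IsCausalTF (W₂ * W₁⁻¹))
    (hW₂ : IsMinimumPhase W₂) :
    ∃ (Fplus : Matrix (Fin m) (Fin p) (RatFunc ℝ)) (Kplus : Matrix (Fin m) (Fin m) ℝ)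
      (v : RandProc (Fin m) μ),
      -- a feedback representation with `F = z⁻¹ Fplus` and constant `K = Kplus`
      IsStableTF Fplus ∧
      IsMinimumPhase (constTF Kplus) ∧
      IsFeedbackRepresentation ((RatFunc.X : RatFunc ℝ) • Fplus) (W₂ * W₁⁻¹) (constTF Kplus)
        e y₁ y₂ v ∧
      -- `Fplus(z) y₂(t - 1)` is the Wiener predictor, with prediction error `Kplus e(t)`
      IsFilterResponse Fplus (fun t => y₂ (t - 1)) (wienerPredictor y₁ y₂) ∧
      (∀ t i, y₁ t i - wienerPredictor y₁ y₂ t i = ∑ j, Kplus i j • e t j) ∧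
      (∀ t i, v t i = ∑ j, Kplus i j • e t j) ∧
      IsUncorrelatedWithStrictPast v y₂ ∧
      -- every representation with `F = z⁻¹ Fbar`, `Fbar` stable, and constant `K` is of this kind
      (∀ (Fbar : Matrix (Fin m) (Fin p) (RatFunc ℝ)) (H : Matrix (Fin p) (Fin m) (RatFunc ℝ))
        (K : Matrix (Fin m) (Fin m) ℝ) (w : RandProc (Fin m) μ),
        IsStableTF Fbar →
        IsFeedbackRepresentation ((RatFunc.X : RatFunc ℝ) • Fbar) H (constTF K) e y₁ y₂ w →
          K = Kplus ∧
          IsFilterResponse Fbar (fun t => y₂ (t - 1)) (wienerPredictor y₁ y₂)) ∧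
      -- uniqueness of the representation whose noise is uncorrelated with the strict past of `y₂`
      (∀ (F : Matrix (Fin m) (Fin p) (RatFunc ℝ)) (H : Matrix (Fin p) (Fin m) (RatFunc ℝ))
        (K : Matrix (Fin m) (Fin m) (RatFunc ℝ)) (w : RandProc (Fin m) μ),
        IsFeedbackRepresentation F H K e y₁ y₂ w →
        IsUncorrelatedWithStrictPast w y₂ →
          w = v ∧ K = constTF Kplus ∧ H = W₂ * W₁⁻¹ ∧
          F * W₂ = ((RatFunc.X : RatFunc ℝ) • Fplus) * W₂ ∧
          (m = p → F = (RatFunc.X : RatFunc ℝ) • Fplus)) := by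
  have he : IsNormalizedWhiteNoise e := hW.innovation.1
  have hst₁ : IsStableTF W₁ := fun i j => hW.stable (Sum.inl i) j
  have hst₂ : IsStableTF W₂ := hW₂.1
  have hy₁ : IsFilterResponse W₁ e y₁ := fun t i => hW.response t (Sum.inl i)
  have hy₂ : IsFilterResponse W₂ e y₂ := fun t i => hW.response t (Sum.inr i)
  have hbound := he.norm_le
  have hdet : IsUnit W₁.det := hW₁.isUnit
  obtain ⟨L, hL, hLW⟩ := hW₂.exists_left_inverse
  -- `e = L y₂`, so that `y₂` and `e` have the same past spaces
  have heL : IsFilterResponse L y₂ e := by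
    rw [IsFilterResponse.comp_iff hL hst₂ hbound hy₂, hLW, ← constTF_one,
      isFilterResponse_constTF_iff]
    intro t i
    simp [Matrix.one_apply]
  have hpast (t : ℤ) : pastSpace y₂ t = pastSpace e t :=
    le_antisymm (hy₂.pastSpace_le t) (heL.pastSpace_le t)
  have hHW : W₂ * W₁⁻¹ * W₁ = W₂ := by
    rw [Matrix.mul_assoc, Matrix.nonsing_inv_mul _ hdet, Matrix.mul_one]
  have hLft : feedthrough L * feedthrough W₂ = 1 := by
    rw [← feedthrough_mul hL.isCausalTF hst₂.isCausalTF, hLW, feedthrough_one]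
  set K := feedthrough W₁ with hKdef
  -- `L (W₂ W₁⁻¹)` is a causal left inverse of `W₁`; causality of the feedback channel is used here
  have hK : IsUnit K := by
    have : feedthrough L * feedthrough (W₂ * W₁⁻¹) * K = 1 := by
      rw [Matrix.mul_assoc, hKdef, ← feedthrough_mul hH hst₁.isCausalTF, hHW, hLft]
    exact .of_mul_eq_one_right _ this
  obtain ⟨M, hM, hWM⟩ := exists_eq_X_smul (hst₁.sub (isStableTF_constTF K))
    (by rw [feedthrough_sub, feedthrough_constTF, sub_self])
  set v : RandProc (Fin m) μ := fun t i => ∑ j, K i j • e t j with hv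
  have hvK : IsFilterResponse (constTF K) e v := isFilterResponse_constTF_iff.2 fun _ _ => rfl
  have herr : ∀ t i, y₁ t i - wienerPredictor y₁ y₂ t i = v t i :=
    sub_wienerPredictor_eq he hst₁ hy₁ hpast
  have hpred : wienerPredictor y₁ y₂ = fun t i => y₁ t i - v t i := by
    ext1 t
    ext1 i
    rw [← herr t i, sub_sub_cancel]
  -- a stable `G` with `z⁻¹ G W₂ = W₁ - K` produces the predictor
  have hresp {G : Matrix (Fin m) (Fin p) (RatFunc ℝ)} (hG : IsStableTF G)
      (h : W₁ - constTF K = (RatFunc.X : RatFunc ℝ) • G * W₂) :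
      IsFilterResponse G (fun t => y₂ (t - 1)) (wienerPredictor y₁ y₂) := by
    rw [IsFilterResponse.comp_iff hG hst₂ (fun t j => hbound (t - 1) j) (hy₂.shift 1), hpred]
    refine IsFilterResponse.delay (hG.mul hst₂).isCausalTF ?_
    rw [← Matrix.smul_mul, ← h]
    exact hy₁.sub hvK
  have hF : IsStableTF (M * L) := hM.mul hL
  have hXF : IsStableTF ((RatFunc.X : RatFunc ℝ) • (M * L)) := .smul (X_mem_regularOn _) hF
  have hFW : W₁ - constTF K = (RatFunc.X : RatFunc ℝ) • (M * L) * W₂ := by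
    rw [Matrix.smul_mul, Matrix.mul_assoc, hLW, Matrix.mul_one, hWM]
  refine ⟨M * L, K, v, hF, isMinimumPhase_constTF hK, ⟨isStableTF_constTF K, hvK, ?_⟩,
    hresp hF hFW, herr, fun _ _ => rfl, ?_, ?_, ?_⟩
  · exact
      { stationary := isWideSenseStationary_noise he K
        uncorrelated := fun t s i j => by simp
        causal_F := hXF.isCausalTF
        causal_H := hH
        delay := .inl ⟨_, hF.isCausalTF, rfl⟩
        internally_stable := isInternallyStable_of_eq hst₁ hst₂ hXF hW₁ hK
          (by rw [← hFW, sub_add_cancel])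
        forward := (isTransferRelation_iff he (hst₁.sub (isStableTF_constTF K)) hst₂ hy₂
          (hy₁.sub hvK)).2 hFW
        feedback := by
          simpa using (isTransferRelation_iff he hst₂ hst₁ hy₁ hy₂).2 hHW.symm }
  · intro t s hst i j
    simp only [hv, sum_inner, inner_smul_left, hy₂.inner_future he hst j, mul_zero,
      Finset.sum_const_zero]
  · intro Fbar H K' w hFbar hrep
    have h1 := (hrep.transfer_eq he hst₁ hst₂ hy₁ hy₂).1
    have hKK : K' = K := by
      have h2 := congr_arg feedthrough h1
      rw [feedthrough_sub, feedthrough_constTF, feedthrough_mul hrep.model.causal_F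
        hst₂.isCausalTF, IsStrictlyCausalTF.feedthrough_eq_zero ⟨_, hFbar.isCausalTF, rfl⟩,
        Matrix.zero_mul, sub_eq_zero] at h2
      exact h2.symm
    subst hKK
    exact ⟨rfl, hresp hFbar h1⟩
  · intro F H K' w hrep huncor
    obtain ⟨h1, h2⟩ := hrep.transfer_eq he hst₁ hst₂ hy₁ hy₂
    -- `w` is uncorrelated with the strict past of `e`, so the filter `K'` is constant
    have hconst : K' = constTF (feedthrough K') := by
      ext1 i j
      refine eq_of_impulseCoeff_eq (isCausalTF_iff.1 hrep.stable_K.isCausalTF i j)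
        (C_mem_regularOn _ _) fun k => ?_
      rw [constTF, Matrix.map_apply, impulseCoeff_C]
      split_ifs with hk
      · rw [hk, feedthrough, Matrix.map_apply]
      · rw [← hrep.noise.inner_past he 0 i k j]
        refine inner_eq_zero_of_mem_pastSpace (y := y₂) (t := 0 - k)
          (fun s hs l => huncor 0 s (by omega) i l) ?_
        rw [hpast]
        exact Submodule.le_topologicalClosure _ (Submodule.subset_span ⟨_, le_rfl, j, rfl⟩)
    have hKK : feedthrough K' = K := by
      rcases hrep.model.delay with hd | hd
      · have h3 := congr_arg feedthrough h1
        rw [feedthrough_sub, feedthrough_mul hrep.model.causal_F hst₂.isCausalTF,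
          hd.feedthrough_eq_zero, Matrix.zero_mul, sub_eq_zero] at h3
        exact h3.symm
      · -- a strictly causal `H` forces `W₂(∞) = 0`, which is possible only if `m = 0`
        have h3 := congr_arg feedthrough h2
        rw [feedthrough_mul hrep.model.causal_H hst₁.isCausalTF, hd.feedthrough_eq_zero,
          Matrix.zero_mul] at h3
        rw [h3, Matrix.mul_zero] at hLft
        rw [← Matrix.mul_one (feedthrough K'), ← Matrix.mul_one K, ← hLft, Matrix.mul_zero,
          Matrix.mul_zero]
    rw [hKK] at hconst
    have hFW' : F * W₂ = (RatFunc.X : RatFunc ℝ) • (M * L) * W₂ := by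
      rw [← h1, hconst, hFW]
    refine ⟨?_, hconst, ?_, hFW', ?_⟩
    · ext1 t
      ext1 i
      have hw := hrep.noise
      rw [hconst, isFilterResponse_constTF_iff] at hw
      exact hw t i
    · rw [h2, Matrix.mul_assoc, Matrix.mul_nonsing_inv _ hdet, Matrix.mul_one]
    · rintro rfl
      have hWL : W₂ * L = 1 := mul_eq_one_comm.1 hLW
      rw [← Matrix.mul_one F, ← hWL, ← Matrix.mul_assoc, hFW', Matrix.mul_assoc, hWL,
        Matrix.mul_one]
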